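/- Let $d\ge 3$ and $n\ge 0$. A \emph{stacked $d$-polytope} of type $\mathrm{Stack}(n,d)$ is a $d$-polytope combinatorially equivalent to one obtained from a $d$-simplex by $n$ times successively stacking a pyramid onto a simplex facet, i.e. by replacing a polytope $P$ with $\operatorname{conv}(P\cup\{w\})$, where $w$ is a point beyond one facet of $P$, which is a simplex, and beneath all other facets of $P$. Two polytopes are combinatorially equivalent if their face lattices are isomorphic. A $d$-polytope $Q\subset\mathbb{R}^d$ \emph{admits a deep vertex truncation} if there are closed halfspaces $H_v^-$, bounded by hyperplanes $H_v$, one for each vertex $v$ of $Q$ and with $v\notin H_v^-$, and points $p_e$ in the relative interiors of the edges $e$ of $Q$, such that for every edge $e$ $$e\,\cap\,\bigcap_{v\in V(Q)}H_v^-=\{p_e\},$$ and such that for every vertex $v$ the points $p_e$ on the edges $e$ containing $v$ all lie on $H_v$. \textbf{Theorem} (Paffenholz and Ziegler). Every stacked $d$-polytope of type $\mathrm{Stack}(n,d)$ is combinatorially equivalent to a $d$-polytope $Q\subset\mathbb{R}^d$ that admits a deep vertex truncation. -/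

import Mathlib

/-- `P` is a `d`-polytope in `ℝ^d`: the convex hull of finitely many points, of full dimension. -/
def IsFullPolytope {d : ℕ} (P : Set (EuclideanSpace ℝ (Fin d))) : Prop :=
  (∃ s : Set (EuclideanSpace ℝ (Fin d)), s.Finite ∧ P = convexHull ℝ s) ∧
    affineSpan ℝ P = ⊤

/-- `P` is a `k`-simplex: the convex hull of `k + 1` affinely independent points. -/
def IsGeomSimplex {d : ℕ} (k : ℕ) (P : Set (EuclideanSpace ℝ (Fin d))) : Prop :=
  ∃ p : Fin (k + 1) → EuclideanSpace ℝ (Fin d),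
    AffineIndependent ℝ p ∧ P = convexHull ℝ (Set.range p)

/-- The face poset of `P`, ordered by inclusion. A face is a set cut out by a supporting
hyperplane; the empty set and `P` itself are included (this is how `IsExposed` is set up). -/
abbrev FacePoset {d : ℕ} (P : Set (EuclideanSpace ℝ (Fin d))) : Type :=
  {F : Set (EuclideanSpace ℝ (Fin d)) // IsExposed ℝ P F}

/-- `P` and `Q` have the same combinatorial type: their face lattices are isomorphic. -/
def CombEquiv {d : ℕ} (P Q : Set (EuclideanSpace ℝ (Fin d))) : Prop :=
  Nonempty (FacePoset P ≃o FacePoset Q)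

/-- An edge is a face of dimension `1`. -/
def IsEdge {d : ℕ} (P e : Set (EuclideanSpace ℝ (Fin d))) : Prop :=
  IsExposed ℝ P e ∧ Module.finrank ℝ (vectorSpan ℝ e) = 1

/-- A facet of a full-dimensional polytope in `ℝ^d` is a face of dimension `d - 1`. -/
def IsFacet {d : ℕ} (P F : Set (EuclideanSpace ℝ (Fin d))) : Prop :=
  IsExposed ℝ P F ∧ F.Nonempty ∧ Module.finrank ℝ (vectorSpan ℝ F) + 1 = d

/-- `w` lies beyond the facet `F` of `P`: the hyperplane of `F` strictly separates `w`
from the interior of `P`. -/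
def IsBeyond {d : ℕ} (P F : Set (EuclideanSpace ℝ (Fin d)))
    (w : EuclideanSpace ℝ (Fin d)) : Prop :=
  ∃ (l : EuclideanSpace ℝ (Fin d) →L[ℝ] ℝ) (c : ℝ),
    (∀ x ∈ P, l x ≤ c) ∧ F = {x ∈ P | l x = c} ∧ c < l w

/-- `w` lies beneath the facet `F` of `P`: it lies strictly on the same side of the hyperplane
of `F` as the interior of `P`. -/
def IsBeneath {d : ℕ} (P F : Set (EuclideanSpace ℝ (Fin d)))
    (w : EuclideanSpace ℝ (Fin d)) : Prop :=
  ∃ (l : EuclideanSpace ℝ (Fin d) →L[ℝ] ℝ) (c : ℝ),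
    (∀ x ∈ P, l x ≤ c) ∧ F = {x ∈ P | l x = c} ∧ l w < c

/-- `P'` is obtained from `P` by stacking a pyramid onto a simplex facet `F` of `P`: its apex `w`
lies beyond `F` and beneath all other facets. -/
def IsStackingOf {d : ℕ} (P P' : Set (EuclideanSpace ℝ (Fin d))) : Prop :=
  ∃ (F : Set (EuclideanSpace ℝ (Fin d))) (w : EuclideanSpace ℝ (Fin d)),
    IsFacet P F ∧ IsGeomSimplex (d - 1) F ∧ IsBeyond P F w ∧
    (∀ G, IsFacet P G → G ≠ F → IsBeneath P G w) ∧
    P' = convexHull ℝ (insert w P)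

/-- `IsIteratedStacking n P`: `P` is obtained from a `d`-simplex in `ℝ^d` by `n` successive
stackings. -/
inductive IsIteratedStacking {d : ℕ} : ℕ → Set (EuclideanSpace ℝ (Fin d)) → Prop
  | simplex (P : Set (EuclideanSpace ℝ (Fin d))) : IsGeomSimplex d P → IsIteratedStacking 0 P
  | stack (n : ℕ) (P P' : Set (EuclideanSpace ℝ (Fin d))) :
      IsIteratedStacking n P → IsStackingOf P P' → IsIteratedStacking (n + 1) P'

/-- `P` is a `d`-polytope whose combinatorial type is one of the types `Stack(n, d)`. -/
def HasStackType {d : ℕ} (n : ℕ) (P : Set (EuclideanSpace ℝ (Fin d))) : Prop :=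
  IsFullPolytope P ∧
    ∃ P₀ : Set (EuclideanSpace ℝ (Fin d)), IsIteratedStacking n P₀ ∧ CombEquiv P P₀

/-- What remains of `P` after intersecting it with the closed halfspaces
`{x | f v x ≤ c v}`, one for each vertex `v` of `P`. -/
def vertexTruncation {d : ℕ} (P : Set (EuclideanSpace ℝ (Fin d)))
    (f : EuclideanSpace ℝ (Fin d) → (EuclideanSpace ℝ (Fin d) →L[ℝ] ℝ))
    (c : EuclideanSpace ℝ (Fin d) → ℝ) : Set (EuclideanSpace ℝ (Fin d)) :=
  P ∩ ⋂ v ∈ P.extremePoints ℝ, {x | f v x ≤ c v}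

/-- `P` admits a deep vertex truncation: there are closed halfspaces
`{x | f v x ≤ c v}`, one for each vertex `v` and not containing `v`, and relative interior points
`p e` of the edges `e`, such that `p e` is all that remains of `e` in the truncated
polytope, and for each vertex `v` the points `p e` on the edges `e` at `v` lie on the
hyperplane `{x | f v x = c v}`. -/
def AdmitsDeepVertexTruncation {d : ℕ} (P : Set (EuclideanSpace ℝ (Fin d))) : Prop :=
  ∃ (f : EuclideanSpace ℝ (Fin d) → (EuclideanSpace ℝ (Fin d) →L[ℝ] ℝ))
    (c : EuclideanSpace ℝ (Fin d) → ℝ)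
    (p : Set (EuclideanSpace ℝ (Fin d)) → EuclideanSpace ℝ (Fin d)),
    (∀ v ∈ P.extremePoints ℝ, f v ≠ 0 ∧ c v < f v v) ∧
    (∀ e, IsEdge P e →
      p e ∈ intrinsicInterior ℝ e ∧
      e ∩ vertexTruncation P f c = {p e} ∧
      ∀ v ∈ P.extremePoints ℝ, v ∈ e → f v (p e) = c v)

open Set Filter Topology

/-! The polytope `Q` is built together with its truncation. Attach to each vertex `x i` an affine
function `h i`, negative at `x i` and positive at all other vertices. On an edge `ij` the zeros of
`h i` and `h j` coincide exactly when `h i (x i) * h j (x j) = h i (x j) * h j (x i)`, and every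
other `h k` is positive on that edge. So these conditions (`IsDeepCut`) give a deep vertex
truncation. For a simplex, cutting at the edge midpoints works.

The conditions survive stacking onto any facet `S` if the apex is well chosen
(`IsDeepCut.exists_stack`). Averaging the points that remain on the edges of `S` gives a relative
interior point `z` of the facet with every `h k z > 0`; this needs `d ≥ 3`, so that for each `k`
some edge of `S` avoids `x k`. An apex `w` slightly beyond `z` keeps this positivity and stays
beneath the other facets. The new hyperplane is then forced: on the edge from `w` to `x i` it must
pass through the zero of `h i`. These `d` points determine, up to scaling, an affine `H` that is
negative at `w` and positive on the vertices of `S`. It is positive at the remaining vertices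
because the old polytope lies in the cone from `w` over the facet (`IsFacetSystem.coord_pos`).

The face lattice depends only on the vertex sets of the facets (`IsFacetSystem.nonempty_orderIso`),
and stacking changes these by a rule independent of the position of the apex
(`IsFacetSystem.stack`). Running the given stackings and the well-chosen ones in parallel, on the
same facets, yields combinatorially equivalent polytopes. -/

variable {E : Type*} [NormedAddCommGroup E] [NormedSpace ℝ E] {ι : Type*}

/-! ### Affine functions, exposed faces and convex hulls -/

theorem AffineMap.nonneg_of_mem_convexHull {s : Set E} {g : E →ᵃ[ℝ] ℝ} (hg : ∀ x ∈ s, 0 ≤ g x)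
    {z : E} (hz : z ∈ convexHull ℝ s) : 0 ≤ g z :=
  convexHull_min (t := g ⁻¹' Ici 0) hg ((convex_Ici 0).affine_preimage g) hz

theorem AffineMap.eq_zero_of_mem_convexHull {s : Set E} {g : E →ᵃ[ℝ] ℝ} (hg : ∀ x ∈ s, g x = 0)
    {z : E} (hz : z ∈ convexHull ℝ s) : g z = 0 :=
  convexHull_min (t := g ⁻¹' {0}) hg ((convex_singleton 0).affine_preimage g) hz

/-- The zero set of an affine function that is nonnegative on `A` is exposed. -/
theorem isExposed_zeros_of_nonneg [FiniteDimensional ℝ E] {A : Set E} {g : E →ᵃ[ℝ] ℝ}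
    (hg : ∀ z ∈ A, 0 ≤ g z) : IsExposed ℝ A {z ∈ A | g z = 0} := by
  rintro ⟨z₀, hz₀A, hz₀⟩
  have key : ∀ z, g z = g.linear z + g 0 := fun z => congrFun g.decomp z
  refine ⟨-(LinearMap.toContinuousLinearMap g.linear), ?_⟩
  ext z
  constructor
  · rintro ⟨hz, h⟩
    refine ⟨hz, fun y hy => ?_⟩
    have h1 := hg y hy
    rw [key] at h h1
    simp only [neg_apply, LinearMap.coe_toContinuousLinearMap']
    linarith
  · rintro ⟨hz, h⟩
    refine ⟨hz, ?_⟩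
    have h1 := hg z hz
    have h2 := h z₀ hz₀A
    simp only [neg_apply, LinearMap.coe_toContinuousLinearMap'] at h2
    rw [key] at hz₀ h1 ⊢
    linarith

theorem IsExposed.exists_affineMap {A B : Set E} (h : IsExposed ℝ A B) (hB : B.Nonempty) :
    ∃ g : E →ᵃ[ℝ] ℝ, (∀ z ∈ A, 0 ≤ g z) ∧ B = {z ∈ A | g z = 0} := by
  obtain ⟨l, rfl⟩ := h hB
  obtain ⟨z₀, hz₀A, hz₀⟩ := hB
  refine ⟨AffineMap.const ℝ E (l z₀) - (l : E →ₗ[ℝ] ℝ).toAffineMap, fun z hz => ?_, ?_⟩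
  · simpa using hz₀ z hz
  · ext z
    constructor
    · rintro ⟨hz, h⟩
      exact ⟨hz, by simpa using sub_eq_zero.2 (le_antisymm (h z₀ hz₀A) (hz₀ z hz))⟩
    · rintro ⟨hz, h⟩
      have : l z₀ = l z := by simpa [sub_eq_zero] using h
      exact ⟨hz, fun y hy => this ▸ hz₀ y hy⟩

/-- A face of a polytope is the convex hull of the vertices it contains. -/
theorem IsExposed.eq_convexHull_image [Finite ι] {x : ι → E} {B : Set E}
    (h : IsExposed ℝ (convexHull ℝ (range x)) B) : B = convexHull ℝ (x '' {i | x i ∈ B}) := by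
  have hc : Convex ℝ B := h.convex (convex_convexHull ℝ _)
  refine Subset.antisymm ?_ (convexHull_min (by rintro _ ⟨i, hi, rfl⟩; exact hi) hc)
  have hcomp : IsCompact B := h.isCompact ((finite_range x).isCompact_convexHull ℝ)
  have hcl : IsClosed (convexHull ℝ (x '' {i | x i ∈ B})) :=
    ((toFinite (x '' {i | x i ∈ B})).isCompact_convexHull ℝ).isClosed
  have hext : B.extremePoints ℝ ⊆ x '' {i | x i ∈ B} := by
    intro z hz
    obtain ⟨i, rfl⟩ :=
      extremePoints_convexHull_subset (h.isExtreme.extremePoints_subset_extremePoints hz)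
    exact ⟨i, (extremePoints_subset hz : x i ∈ B), rfl⟩
  -- Krein–Milman for the face; the hull of finitely many points is already closed.
  calc B = closure (convexHull ℝ (B.extremePoints ℝ)) :=
        (closure_convexHull_extremePoints hcomp hc).symm
    _ ⊆ _ := closure_minimal (convexHull_mono hext) hcl

/-- Finitely many affine functions that are nonnegative on a convex set, each of them positive
somewhere on it, are simultaneously positive at some point of it. -/
theorem Convex.exists_forall_pos {K : Set E} (hK : Convex ℝ K) (hne : K.Nonempty) {α : Type*}
    {t : Set α} (ht : t.Finite) {g : α → E →ᵃ[ℝ] ℝ} (h0 : ∀ a ∈ t, ∀ z ∈ K, 0 ≤ g a z)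
    (h1 : ∀ a ∈ t, ∃ z ∈ K, 0 < g a z) : ∃ z ∈ K, ∀ a ∈ t, 0 < g a z := by
  induction t, ht using Set.Finite.induction_on with
  | empty => exact ⟨hne.some, hne.some_mem, by simp⟩
  | @insert a s _ _ ih =>
    obtain ⟨z₁, hz₁, h₁⟩ := ih (fun b hb => h0 b (mem_insert_of_mem _ hb))
      (fun b hb => h1 b (mem_insert_of_mem _ hb))
    obtain ⟨z₂, hz₂, h₂⟩ := h1 a (mem_insert _ _)
    refine ⟨AffineMap.lineMap z₁ z₂ (1 / 2 : ℝ), hK.lineMap_mem hz₁ hz₂ (by norm_num), ?_⟩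
    intro b hb
    rw [AffineMap.apply_lineMap, AffineMap.lineMap_apply_ring]
    rcases hb with rfl | hb
    · have := h0 b (mem_insert _ _) z₁ hz₁
      linarith
    · have := h0 b (mem_insert_of_mem _ hb) z₂ hz₂
      have := h₁ b hb
      linarith

/-- Moving a little from a point where finitely many affine functions are positive. -/
theorem exists_pos_lineMap [FiniteDimensional ℝ E] {α : Type*} {t : Set α} (ht : t.Finite)
    {g : α → E →ᵃ[ℝ] ℝ} {z : E} (hz : ∀ a ∈ t, 0 < g a z) (y : E) :
    ∃ ε : ℝ, 0 < ε ∧ ∀ a ∈ t, 0 < g a (AffineMap.lineMap z y (-ε)) := by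
  have : ∀ᶠ ε : ℝ in 𝓝 0, ∀ a ∈ t, 0 < g a (AffineMap.lineMap z y (-ε)) := by
    rw [ht.eventually_all]
    intro a ha
    have hc : Continuous fun ε : ℝ => g a (AffineMap.lineMap z y (-ε)) :=
      (g a).continuous_of_finiteDimensional.comp
        ((AffineMap.lineMap_continuous (R := ℝ)).comp continuous_neg)
    exact (hc.tendsto 0).eventually (lt_mem_nhds (by simpa using hz a ha))
  have h2 : ∀ᶠ ε : ℝ in 𝓝[>] 0, ∀ a ∈ t, 0 < g a (AffineMap.lineMap z y (-ε)) :=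
    this.filter_mono nhdsWithin_le_nhds
  obtain ⟨ε, h, hε⟩ := (h2.and self_mem_nhdsWithin).exists
  exact ⟨ε, hε, h⟩

/-- An affine function with different values at `u` and `v` is a coordinate on their line, so an
open interval of its values pulls back to a relatively open part of the segment. -/
theorem openSegment_subset_intrinsicInterior_segment [FiniteDimensional ℝ E] {u v : E}
    {g : E →ᵃ[ℝ] ℝ} (h : g u < g v) :
    openSegment ℝ u v ⊆ intrinsicInterior ℝ (segment ℝ u v) := by
  intro p hp
  have hpseg := openSegment_subset_segment ℝ u v hp
  refine mem_intrinsicInterior.2 ⟨⟨p, subset_affineSpan ℝ _ hpseg⟩, ?_, rfl⟩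
  rw [openSegment_eq_image_lineMap] at hp
  obtain ⟨t, ht, rfl⟩ := hp
  have hc : Continuous fun z : affineSpan ℝ (segment ℝ u v) => g z :=
    g.continuous_of_finiteDimensional.comp continuous_subtype_val
  refine mem_interior.2 ⟨(fun z : affineSpan ℝ (segment ℝ u v) => g z) ⁻¹' Ioo (g u) (g v), ?_,
    isOpen_Ioo.preimage hc, ?_⟩
  · rintro ⟨z, hz⟩ ⟨h1, h2⟩
    rw [← convexHull_pair, affineSpan_convexHull] at hz
    obtain ⟨r, rfl⟩ := mem_affineSpan_pair_iff_exists_lineMap_eq.1 hz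
    simp only [AffineMap.apply_lineMap, AffineMap.lineMap_apply_ring] at h1 h2
    simp only [mem_preimage, segment_eq_image_lineMap]
    exact ⟨r, ⟨by nlinarith, by nlinarith⟩, rfl⟩
  · simp only [mem_preimage, AffineMap.apply_lineMap, AffineMap.lineMap_apply_ring]
    constructor <;> nlinarith [ht.1, ht.2]

theorem AffineBasis.affineMap_ext {κ : Type*} (b : AffineBasis κ ℝ E) {f g : E →ᵃ[ℝ] ℝ}
    (h : ∀ k, f (b k) = g (b k)) : f = g :=
  AffineMap.ext_on b.tot (by rintro _ ⟨k, rfl⟩; exact h k)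

/-- An affinely independent family of `finrank ℝ E` points in a hyperplane, together with a point
off that hyperplane, is an affine basis. -/
theorem exists_affineBasis_option [FiniteDimensional ℝ E] {x : ι → E} {S : Set ι} [Finite S]
    (hcard : S.ncard = Module.finrank ℝ E) (hS : AffineIndependent ℝ fun i : S => x i)
    {g : E →ᵃ[ℝ] ℝ} (hg : ∀ i ∈ S, g (x i) = 0) {w : E} (hw : g w ≠ 0) :
    ∃ b : AffineBasis (Option S) ℝ E, (∀ i : S, b (some i) = x i) ∧ b none = w := by
  have := Fintype.ofFinite S
  let p : Option S → E := fun o => o.elim w fun i => x i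
  have hp : AffineIndependent ℝ p := by
    refine AffineIndependent.affineIndependent_of_notMem_span (i := none) ?_ ?_
    · let e : {y : Option S // y ≠ none} ↪ S :=
        ⟨fun y => y.1.get (Option.isSome_iff_ne_none.2 y.2), fun y y' h => by
          ext1
          exact Option.get_inj.1 h⟩
      convert! hS.comp_embedding e using 1
      ext1 ⟨y, hy⟩
      cases y with
      | none => exact absurd rfl hy
      | some y => rfl
    · intro hmem
      have hle : affineSpan ℝ (p '' {y | y ≠ none}) ≤ (affineSpan ℝ {(0 : ℝ)}).comap g := by
        rw [affineSpan_le]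
        rintro _ ⟨y, hy, rfl⟩
        cases y with
        | none => exact absurd rfl hy
        | some y => simp [p, hg y y.2]
      have := hle hmem
      simp [p] at this
      exact hw this
  have htop : affineSpan ℝ (range p) = ⊤ := by
    rw [hp.affineSpan_eq_top_iff_card_eq_finrank_add_one, Fintype.card_option, ← hcard,
      ← Nat.card_coe_set_eq, Nat.card_eq_fintype_card]
  exact ⟨⟨p, hp, htop⟩, fun _ => rfl, rfl⟩

/-! ### Supporting functions and facet systems -/

/-- The affine function `g` is nonnegative on the family `x` and vanishes exactly at the points
indexed by `S`. -/
def SupportsAt (x : ι → E) (S : Set ι) (g : E →ᵃ[ℝ] ℝ) : Prop :=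
  (∀ i ∈ S, g (x i) = 0) ∧ ∀ i ∉ S, 0 < g (x i)

namespace SupportsAt

variable {x : ι → E} {S : Set ι} {g : E →ᵃ[ℝ] ℝ}

theorem nonneg_apply (h : SupportsAt x S g) (i : ι) : 0 ≤ g (x i) := by
  by_cases hi : i ∈ S
  · exact (h.1 i hi).ge
  · exact (h.2 i hi).le

theorem nonneg (h : SupportsAt x S g) {z : E} (hz : z ∈ convexHull ℝ (range x)) : 0 ≤ g z :=
  AffineMap.nonneg_of_mem_convexHull (by rintro _ ⟨i, rfl⟩; exact h.nonneg_apply i) hz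

theorem apply_eq_zero_iff (h : SupportsAt x S g) {i : ι} : g (x i) = 0 ↔ i ∈ S :=
  ⟨fun h0 => by_contra fun hi => (h.2 i hi).ne' h0, h.1 i⟩

theorem isExposed [FiniteDimensional ℝ E] (h : SupportsAt x S g) :
    IsExposed ℝ (convexHull ℝ (range x)) {z ∈ convexHull ℝ (range x) | g z = 0} :=
  isExposed_zeros_of_nonneg fun _ hz => h.nonneg hz

theorem zeros_eq [FiniteDimensional ℝ E] [Finite ι] (h : SupportsAt x S g) :
    {z ∈ convexHull ℝ (range x) | g z = 0} = convexHull ℝ (x '' S) := by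
  rw [h.isExposed.eq_convexHull_image]
  congr 2
  ext i
  exact ⟨fun hi => h.apply_eq_zero_iff.1 hi.2,
    fun hi => ⟨subset_convexHull ℝ _ (mem_range_self i), h.1 i hi⟩⟩

/-- The points of `S` and one further vertex form an affine basis, so a supporting function of a
facet is fixed by its positive value at that vertex. -/
theorem eq_smul [FiniteDimensional ℝ E] {g' : E →ᵃ[ℝ] ℝ} [Finite S]
    (h : SupportsAt x S g) (h' : SupportsAt x S g') (hcard : S.ncard = Module.finrank ℝ E)
    (hS : AffineIndependent ℝ fun i : S => x i) (hne : S ≠ univ) :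
    ∃ k : ℝ, 0 < k ∧ g' = k • g := by
  obtain ⟨j, hj⟩ := (ne_univ_iff_exists_notMem S).1 hne
  obtain ⟨b, hb, hb'⟩ := exists_affineBasis_option hcard hS h.1 (h.2 j hj).ne'
  refine ⟨g' (x j) / g (x j), div_pos (h'.2 j hj) (h.2 j hj), b.affineMap_ext ?_⟩
  rintro (_ | i)
  · have := (h.2 j hj).ne'
    simp [hb']
    field_simp
  · simp [hb, h.1 i i.2, h'.1 i i.2]

end SupportsAt

/-- The points `x` are the vertices of a full-dimensional simplicial polytope whose facets are the
simplices spanned by the members of `𝓕`. -/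
structure IsFacetSystem (x : ι → E) (𝓕 : Set (Set ι)) : Prop where
  ncard_eq : ∀ S ∈ 𝓕, S.ncard = Module.finrank ℝ E
  affineIndependent : ∀ S ∈ 𝓕, AffineIndependent ℝ fun i : S => x i
  ne_univ : ∀ S ∈ 𝓕, S ≠ univ
  exists_mem : ∀ i, ∃ S ∈ 𝓕, i ∈ S
  exists_supportsAt : ∀ S ∈ 𝓕, ∃ g, SupportsAt x S g
  mem_convexHull : ∀ z, (∀ S ∈ 𝓕, ∀ g, SupportsAt x S g → 0 ≤ g z) → z ∈ convexHull ℝ (range x)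

namespace IsFacetSystem

variable [FiniteDimensional ℝ E] [Finite ι] {x : ι → E} {𝓕 : Set (Set ι)}

/-- Supporting functions of a facet agree up to a positive factor, so one inequality per facet
suffices to describe the polytope. -/
theorem exists_family (h : IsFacetSystem x 𝓕) : ∃ g : Set ι → E →ᵃ[ℝ] ℝ,
    (∀ S ∈ 𝓕, SupportsAt x S (g S)) ∧
      ∀ z, (∀ S ∈ 𝓕, 0 ≤ g S z) → z ∈ convexHull ℝ (range x) := by
  have := h.exists_supportsAt
  choose! g hg using this
  refine ⟨g, hg, fun z hz => h.mem_convexHull z fun S hS g' hg' => ?_⟩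
  obtain ⟨k, hk, rfl⟩ := (hg S hS).eq_smul hg' (h.ncard_eq S hS) (h.affineIndependent S hS)
    (h.ne_univ S hS)
  exact mul_nonneg hk.le (hz S hS)

theorem exists_affineBasis (h : IsFacetSystem x 𝓕) {S : Set ι} (hS : S ∈ 𝓕) {g : E →ᵃ[ℝ] ℝ}
    (hg : SupportsAt x S g) {w : E} (hw : g w ≠ 0) :
    ∃ b : AffineBasis (Option S) ℝ E, (∀ i : S, b (some i) = x i) ∧ b none = w :=
  exists_affineBasis_option (h.ncard_eq S hS) (h.affineIndependent S hS) hg.1 hw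

omit [FiniteDimensional ℝ E] [Finite ι] in
theorem injective (h : IsFacetSystem x 𝓕) : Function.Injective x := by
  intro i j hij
  obtain ⟨S, hS, hi⟩ := h.exists_mem i
  obtain ⟨g, hg⟩ := h.exists_supportsAt S hS
  have hj : j ∈ S := hg.apply_eq_zero_iff.1 (hij ▸ hg.1 i hi)
  exact congrArg Subtype.val
    ((h.affineIndependent S hS).injective (a₁ := ⟨i, hi⟩) (a₂ := ⟨j, hj⟩) hij)

/-- Every subset of a member of `𝓕` is cut out by a supporting hyperplane. -/
theorem exists_supportsAt_of_subset (h : IsFacetSystem x 𝓕) {S T : Set ι} (hS : S ∈ 𝓕)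
    (hT : T ⊆ S) : ∃ g, SupportsAt x T g := by
  classical
  obtain ⟨g, hg⟩ := h.exists_supportsAt S hS
  obtain ⟨j, hj⟩ := (ne_univ_iff_exists_notMem S).1 (h.ne_univ S hS)
  obtain ⟨b, hb, -⟩ := h.exists_affineBasis hS hg (hg.2 j hj).ne'
  have := Fintype.ofFinite S
  -- `m` is `0` on `T` and `1` on `S \ T`. Tilting `g` by a small positive multiple of `m` frees the
  -- points of `S \ T` and keeps those off `S` positive.
  let m : E →ᵃ[ℝ] ℝ := ∑ i : S, if (i : ι) ∈ T then 0 else b.coord (some i)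
  have hm : ∀ i : S, m (x i) = if (i : ι) ∈ T then 0 else 1 := by
    intro i
    have h1 : ∀ k : S, (if (k : ι) ∈ T then (0 : E →ᵃ[ℝ] ℝ) else b.coord (some k)) (x i) =
        if k = i then (if (i : ι) ∈ T then 0 else 1) else 0 := by
      intro k
      rw [← hb i]
      by_cases hk : (k : ι) ∈ T
      · by_cases hki : k = i
        · subst hki; simp [hk]
        · simp [hk, hki]
      · by_cases hki : k = i
        · subst hki; simp [hk]
        · simp [hk, hki]
    have h2 : m (x i) = ∑ k : S,
        (if (k : ι) ∈ T then (0 : E →ᵃ[ℝ] ℝ) else b.coord (some k)) (x i) := by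
      let ev : (E →ᵃ[ℝ] ℝ) →+ ℝ :=
        { toFun := fun f => f (x i), map_zero' := rfl, map_add' := fun _ _ => rfl }
      exact map_sum ev (fun k : S => if (k : ι) ∈ T then (0 : E →ᵃ[ℝ] ℝ) else b.coord (some k)) Finset.univ
    rw [h2, Finset.sum_congr rfl fun k _ => h1 k]
    simp
  have hev : ∀ᶠ ε : ℝ in 𝓝 0, ∀ i, i ∉ S → 0 < g (x i) + ε * m (x i) := by
    rw [eventually_all]
    intro i
    by_cases hi : i ∈ S
    · simp [hi]
    · have hc : Continuous fun ε : ℝ => g (x i) + ε * m (x i) := by fun_prop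
      filter_upwards [(hc.tendsto 0).eventually (lt_mem_nhds (a := 0) (by simpa using hg.2 i hi))]
        with ε hε _ using hε
  obtain ⟨ε, h1, hε⟩ := ((hev.filter_mono nhdsWithin_le_nhds).and
    (self_mem_nhdsWithin (s := Ioi 0))).exists
  refine ⟨g + ε • m, fun i hi => ?_, fun i hi => ?_⟩
  · have := hm ⟨i, hT hi⟩
    simp only [hi, if_true] at this
    simp [hg.1 i (hT hi), this]
  · by_cases hiS : i ∈ S
    · have := hm ⟨i, hiS⟩
      simp only [hi, if_false] at this
      simpa [hg.1 i hiS, this] using hε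
    · simpa using h1 i hiS

/-- A proper face lies in a facet. -/
theorem exists_subset_of_isExposed (h : IsFacetSystem x 𝓕) {B : Set E}
    (hB : IsExposed ℝ (convexHull ℝ (range x)) B) (hne : B.Nonempty)
    (hne' : {i | x i ∈ B} ≠ univ) : ∃ S ∈ 𝓕, {i | x i ∈ B} ⊆ S := by
  by_contra! hcon
  obtain ⟨g, hg, hmem⟩ := h.exists_family
  obtain ⟨m, hm, hBm⟩ := hB.exists_affineMap hne
  -- If `B` lay in no facet, it would contain a point `z` strictly inside all facet inequalities.
  -- Moving from `z` away from a vertex `x j` off `B` stays in the polytope but makes `m` negative.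
  obtain ⟨z, hzB, hz⟩ := (hB.convex (convex_convexHull ℝ _)).exists_forall_pos hne (toFinite 𝓕)
    (g := g) (fun S hS z hz => (hg S hS).nonneg (hB.subset hz)) (fun S hS => by
      obtain ⟨i, hi, hiS⟩ := not_subset.1 (hcon S hS)
      exact ⟨x i, hi, (hg S hS).2 i hiS⟩)
  obtain ⟨j, hj⟩ := (ne_univ_iff_exists_notMem _).1 hne'
  obtain ⟨ε, hε, hpos⟩ := exists_pos_lineMap (toFinite 𝓕) hz (x j)
  have h1 := hm _ (hmem _ fun S hS => (hpos S hS).le)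
  have hxj := subset_convexHull ℝ _ (mem_range_self (f := x) j)
  have h2 : 0 < m (x j) := by
    refine lt_of_le_of_ne (hm _ hxj) fun h0 => hj ?_
    change x j ∈ B
    rw [hBm]
    exact ⟨hxj, h0.symm⟩
  have h3 : m z = 0 := by rw [hBm] at hzB; exact hzB.2
  rw [AffineMap.apply_lineMap, AffineMap.lineMap_apply_ring, h3] at h1
  nlinarith

end IsFacetSystem

/-! ### Stacking a vertex onto a facet -/

/-- The facets of the polytope obtained by stacking a new vertex, indexed by `none`, onto the
facet `S`. -/
def stackFacets (𝓕 : Set (Set ι)) (S : Set ι) : Set (Set (Option ι)) :=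
  {T | (∃ S' ∈ 𝓕, S' ≠ S ∧ T = some '' S') ∨ ∃ i ∈ S, T = insert none (some '' (S \ {i}))}

theorem range_option_elim {α : Type*} (w : α) (x : ι → α) :
    range (fun o : Option ι => o.elim w x) = insert w (range x) := by
  ext z
  constructor
  · rintro ⟨_ | i, rfl⟩
    · exact mem_insert _ _
    · exact mem_insert_of_mem _ (mem_range_self i)
  · rintro (rfl | ⟨i, rfl⟩)
    · exact ⟨none, rfl⟩
    · exact ⟨some i, rfl⟩

/-- An affine function vanishing on `S` and negative at `w` is a negative multiple of the
barycentric coordinate of `w`. -/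
theorem AffineBasis.eq_smul_coord_none {x : ι → E} {S : Set ι} (b : AffineBasis (Option S) ℝ E)
    (hb : ∀ i : S, b (some i) = x i) {g : E →ᵃ[ℝ] ℝ} (hg : ∀ i ∈ S, g (x i) = 0) (z : E) :
    g z = g (b none) * b.coord none z := by
  have : g = g (b none) • b.coord none := by
    refine b.affineMap_ext ?_
    rintro (_ | i)
    · simp
    · have h0 : b.coord none (b (some i)) = 0 := b.coord_apply_ne (by simp)
      rw [hb] at h0 ⊢
      simp [hg i i.2, h0]
  exact congrFun (congrArg DFunLike.coe this) z

namespace IsFacetSystem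

variable [FiniteDimensional ℝ E] [Finite ι] {x : ι → E} {𝓕 : Set (Set ι)}

/-- Seen from a point `w` beyond the facet `S` and beneath all other facets, the polytope lies in
the cone over that facet. -/
theorem coord_pos (h : IsFacetSystem x 𝓕) {S : Set ι} (hS : S ∈ 𝓕) {g : E →ᵃ[ℝ] ℝ}
    (hg : SupportsAt x S g) {b : AffineBasis (Option S) ℝ E} (hb : ∀ i : S, b (some i) = x i)
    (hgw : g (b none) < 0)
    (hw : ∀ S' ∈ 𝓕, S' ≠ S → ∀ g, SupportsAt x S' g → 0 < g (b none))
    {y : E} (hy : y ∈ convexHull ℝ (range x)) (hgy : 0 < g y) (i : S) :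
    0 < b.coord (some i) y := by
  obtain ⟨f, hf, hmem⟩ := h.exists_family
  set w := b none with hwdef
  -- The parameter at which the segment from `w` to `y` crosses the hyperplane of `S`. The crossing
  -- point `z` is strictly beneath all other facets, since `w` is and `t < 1`.
  set t : ℝ := -g w / (g y - g w) with ht
  have hden : 0 < g y - g w := by linarith
  have ht0 : 0 < t := div_pos (by linarith) hden
  have ht1 : t < 1 := by rw [ht, div_lt_one hden]; linarith
  have htg : (1 - t) * g w + t * g y = 0 := by
    rw [ht]; field_simp; ring
  set z := AffineMap.lineMap w y t with hz
  have happ : ∀ k : E →ᵃ[ℝ] ℝ, k z = (1 - t) * k w + t * k y := by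
    intro k
    rw [hz, AffineMap.apply_lineMap, AffineMap.lineMap_apply_ring]
  have hgz : g z = 0 := by rw [happ, htg]
  have hfz : ∀ S' ∈ 𝓕 \ {S}, 0 < f S' z := by
    rintro S' ⟨hS', hne⟩
    rw [happ]
    have h1 := hw S' hS' hne _ (hf S' hS')
    have h2 := (hf S' hS').nonneg hy
    have h3 : 0 < (1 - t) * f S' w := mul_pos (by linarith) h1
    have h4 := mul_nonneg ht0.le h2
    linarith
  obtain ⟨ε, hε, hpos⟩ := exists_pos_lineMap (toFinite (𝓕 \ {S})) hfz (x i)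
  set z' := AffineMap.lineMap z (x i) (-ε) with hz'
  have hgz' : ∀ k : E →ᵃ[ℝ] ℝ, SupportsAt x S k → k z = 0 → k z' = 0 := by
    intro k hk hkz
    rw [hz', AffineMap.apply_lineMap, AffineMap.lineMap_apply_ring, hkz, hk.1 i i.2]
    ring
  have hfS : f S z = 0 := by
    obtain ⟨k, -, hk⟩ := hg.eq_smul (hf S hS) (h.ncard_eq S hS) (h.affineIndependent S hS)
      (h.ne_univ S hS)
    rw [hk]
    simp [hgz]
  have hz'P : z' ∈ convexHull ℝ (range x) := by
    refine hmem z' fun S' hS' => ?_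
    by_cases hSS : S' = S
    · subst hSS
      exact (hgz' _ (hf S' hS') hfS).ge
    · exact (hpos S' ⟨hS', hSS⟩).le
  have hz'F : z' ∈ convexHull ℝ (x '' S) := by
    rw [← hg.zeros_eq]
    exact ⟨hz'P, hgz' g hg hgz⟩
  have hc : 0 ≤ b.coord (some i) z' := by
    refine AffineMap.nonneg_of_mem_convexHull ?_ hz'F
    rintro _ ⟨j, hj, rfl⟩
    classical
    rw [← hb ⟨j, hj⟩, b.coord_apply]
    split_ifs <;> norm_num
  have hci : b.coord (some i) (x i) = 1 := by rw [← hb i, b.coord_apply_eq]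
  have hcw : b.coord (some i) w = 0 := b.coord_apply_ne (by simp)
  -- Now `hc` reads `0 ≤ (1 + ε) * (t * b.coord (some i) y) - ε`, which forces the coordinate of `y`
  -- to be positive.
  rw [hz', AffineMap.apply_lineMap, AffineMap.lineMap_apply_ring, hci, happ, hcw] at hc
  by_contra! hcon
  have h5 : t * b.coord (some i) y ≤ 0 := mul_nonpos_of_nonneg_of_nonpos ht0.le hcon
  nlinarith

/-- Old facets other than `S` keep their supporting functions. Those of the new facets are the
barycentric coordinates of the simplex on `w` and `S`; `coord_pos` makes them positive at the old
vertices off `S`. -/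
theorem stack (h : IsFacetSystem x 𝓕) (hE : 2 ≤ Module.finrank ℝ E) {S : Set ι} (hS : S ∈ 𝓕)
    {g : E →ᵃ[ℝ] ℝ} (hg : SupportsAt x S g) {w : E} (hgw : g w < 0)
    (hw : ∀ S' ∈ 𝓕, S' ≠ S → ∀ g, SupportsAt x S' g → 0 < g w) :
    IsFacetSystem (fun o : Option ι => o.elim w x) (stackFacets 𝓕 S) := by
  obtain ⟨b, hb, rfl⟩ := h.exists_affineBasis hS hg hgw.ne
  have hsome : ∀ S' : Set ι, ∀ j, some j ∈ some '' S' ↔ j ∈ S' := fun S' j => by simp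
  have hold : ∀ S' ∈ 𝓕, S' ≠ S → ∀ g, SupportsAt x S' g →
      SupportsAt (fun o : Option ι => o.elim (b none) x) (some '' S') g := by
    intro S' hS' hne g' hg'
    refine ⟨?_, ?_⟩
    · rintro _ ⟨j, hj, rfl⟩
      exact hg'.1 j hj
    · rintro (_ | j) hj
      · exact hw S' hS' hne g' hg'
      · exact hg'.2 j fun hj' => hj ⟨j, hj', rfl⟩
  have hnew : ∀ i : S, SupportsAt (fun o : Option ι => o.elim (b none) x)
      (insert none (some '' (S \ {(i : ι)}))) (b.coord (some i)) := by
    intro i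
    refine ⟨?_, ?_⟩
    · rintro _ (rfl | ⟨j, ⟨hj, hji⟩, rfl⟩)
      · exact b.coord_apply_ne (by simp)
      · change b.coord (some i) (x j) = 0
        rw [← hb ⟨j, hj⟩]
        refine b.coord_apply_ne fun h => hji ?_
        rw [Option.some.inj h]; rfl
    · rintro (_ | j) hj
      · exact absurd (mem_insert _ _) hj
      · change 0 < b.coord (some i) (x j)
        by_cases hjS : j ∈ S
        · have hji : j = i := by
            by_contra hji
            exact hj (mem_insert_of_mem _ ⟨j, ⟨hjS, hji⟩, rfl⟩)
          rw [hji, ← hb i, b.coord_apply_eq]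
          exact one_pos
        · exact h.coord_pos hS hg hb hgw hw (subset_convexHull ℝ _ (mem_range_self j))
            (hg.2 j hjS) i
  refine ⟨?_, ?_, ?_, ?_, ?_, ?_⟩
  · rintro _ (⟨S', hS', -, rfl⟩ | ⟨i, hi, rfl⟩)
    · rw [ncard_image_of_injective _ (Option.some_injective ι), h.ncard_eq S' hS']
    · rw [ncard_insert_of_notMem (by simp),
        ncard_image_of_injective _ (Option.some_injective ι), ncard_sdiff_singleton_add_one hi,
        h.ncard_eq S hS]
  · rintro _ (⟨S', hS', -, rfl⟩ | ⟨i, hi, rfl⟩)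
    · let e : (some '' S' : Set (Option ι)) ≃ S' :=
        (Equiv.Set.image some S' (Option.some_injective ι)).symm
      convert! (h.affineIndependent S' hS').comp_embedding e.toEmbedding using 1
      ext1 ⟨_, j, hj, rfl⟩
      have : e ⟨some j, j, hj, rfl⟩ = ⟨j, hj⟩ := by
        rw [Equiv.symm_apply_eq]; rfl
      simp [this]
    · have hmem : ∀ o : (insert none (some '' (S \ {i})) : Set (Option ι)),
          ∃ o' : Option S, o'.map Subtype.val = o.1 := by
        rintro ⟨_, rfl | ⟨j, ⟨hj, -⟩, rfl⟩⟩
        · exact ⟨none, rfl⟩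
        · exact ⟨some ⟨j, hj⟩, rfl⟩
      choose e he using hmem
      have hinj : Function.Injective e := fun o o' hoo => Subtype.ext (by rw [← he, ← he, hoo])
      convert! b.ind.comp_embedding ⟨e, hinj⟩ using 1
      ext1 o
      have h1 := he o
      change (o : Option ι).elim (b none) x = b (e o)
      rw [← h1]
      cases e o with
      | none => rfl
      | some j => exact (hb j).symm
  · rintro _ (⟨S', hS', -, rfl⟩ | ⟨i, hi, rfl⟩) hu
    · have : none ∈ some '' S' := hu ▸ mem_univ _
      simp at this
    · have : some i ∈ insert none (some '' (S \ {i})) := hu ▸ mem_univ _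
      simp at this
  · have key : ∀ j : S, ∃ i ∈ S, i ≠ j := by
      intro j
      have : 1 < S.ncard := by rw [h.ncard_eq S hS]; omega
      exact exists_ne_of_one_lt_ncard this j
    have hSne : S.Nonempty := by
      refine nonempty_of_ncard_ne_zero ?_
      rw [h.ncard_eq S hS]; omega
    rintro (_ | j)
    · obtain ⟨i, hi⟩ := hSne
      exact ⟨_, Or.inr ⟨i, hi, rfl⟩, mem_insert _ _⟩
    · by_cases hj : j ∈ S
      · obtain ⟨i, hi, hij⟩ := key ⟨j, hj⟩
        exact ⟨_, Or.inr ⟨i, hi, rfl⟩, mem_insert_of_mem _ ⟨j, ⟨hj, hij.symm⟩, rfl⟩⟩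
      · obtain ⟨S', hS', hj'⟩ := h.exists_mem j
        exact ⟨_, Or.inl ⟨S', hS', fun h => hj (h ▸ hj'), rfl⟩, j, hj', rfl⟩
  · rintro _ (⟨S', hS', hne, rfl⟩ | ⟨i, hi, rfl⟩)
    · obtain ⟨g', hg'⟩ := h.exists_supportsAt S' hS'
      exact ⟨g', hold S' hS' hne g' hg'⟩
    · exact ⟨_, hnew ⟨i, hi⟩⟩
  · intro z hz
    rw [range_option_elim]
    -- The hyperplane of `S` splits the new polytope: one side is the old polytope, the other the
    -- simplex on `w` and `S`.
    by_cases hgz : 0 ≤ g z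
    · refine convexHull_mono (subset_insert _ _) (h.mem_convexHull z fun S' hS' g' hg' => ?_)
      by_cases hSS : S' = S
      · subst hSS
        obtain ⟨k, hk, rfl⟩ := hg.eq_smul hg' (h.ncard_eq _ hS) (h.affineIndependent _ hS)
          (h.ne_univ _ hS)
        exact mul_nonneg hk.le hgz
      · exact hz _ (Or.inl ⟨S', hS', hSS, rfl⟩) g' (hold S' hS' hSS g' hg')
    · have hzb : z ∈ convexHull ℝ (range b) := by
        rw [b.convexHull_eq_nonneg_coord]
        rintro (_ | i)
        · have := b.eq_smul_coord_none hb hg.1 z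
          push Not at hgz
          nlinarith
        · exact hz _ (Or.inr ⟨i, i.2, rfl⟩) _ (hnew i)
      refine convexHull_mono ?_ hzb
      rintro _ ⟨_ | i, rfl⟩
      · exact mem_insert _ _
      · rw [hb]
        exact mem_insert_of_mem _ (mem_range_self _)

end IsFacetSystem

/-! ### The face lattice of a facet system -/

namespace IsFacetSystem

variable [FiniteDimensional ℝ E] [Finite ι] {x : ι → E} {𝓕 : Set (Set ι)}

theorem affineSpan_convexHull_eq_top [Nonempty ι] (h : IsFacetSystem x 𝓕) :
    affineSpan ℝ (convexHull ℝ (range x)) = ⊤ := by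
  obtain ⟨S, hS, -⟩ := h.exists_mem (Classical.arbitrary ι)
  obtain ⟨g, hg⟩ := h.exists_supportsAt S hS
  obtain ⟨j, hj⟩ := (ne_univ_iff_exists_notMem S).1 (h.ne_univ S hS)
  obtain ⟨b, hb, hb'⟩ := h.exists_affineBasis hS hg (hg.2 j hj).ne'
  rw [affineSpan_convexHull, eq_top_iff, ← b.tot]
  refine affineSpan_mono ℝ ?_
  rintro _ ⟨_ | i, rfl⟩
  · exact hb' ▸ mem_range_self _
  · exact hb i ▸ mem_range_self _

theorem extremePoints_eq (h : IsFacetSystem x 𝓕) :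
    (convexHull ℝ (range x)).extremePoints ℝ = range x := by
  refine Subset.antisymm extremePoints_convexHull_subset ?_
  rintro _ ⟨i, rfl⟩
  obtain ⟨S, hS, hi⟩ := h.exists_mem i
  obtain ⟨g, hg⟩ := h.exists_supportsAt_of_subset hS (singleton_subset_iff.2 hi)
  have := hg.isExposed
  rw [hg.zeros_eq, image_singleton, convexHull_singleton] at this
  exact exposedPoints_subset_extremePoints (mem_exposedPoints_iff_exposed_singleton.2 this)

omit [FiniteDimensional ℝ E] in
theorem finrank_vectorSpan_add_one (h : IsFacetSystem x 𝓕) {S T : Set ι} (hS : S ∈ 𝓕)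
    (hT : T ⊆ S) (hne : T.Nonempty) :
    Module.finrank ℝ (vectorSpan ℝ (convexHull ℝ (x '' T))) + 1 = T.ncard := by
  have := Fintype.ofFinite T
  have hind : AffineIndependent ℝ fun i : T => x i :=
    (h.affineIndependent S hS).comp_embedding ⟨inclusion hT, inclusion_injective hT⟩
  have hcard : Fintype.card T = (T.ncard - 1) + 1 := by
    rw [← Nat.card_eq_fintype_card, Nat.card_coe_set_eq]
    have := (ncard_pos (toFinite T)).2 hne
    omega
  have hfin := hind.finrank_vectorSpan hcard
  rw [← direction_affineSpan, affineSpan_convexHull, direction_affineSpan, image_eq_range, hfin,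
    ← hcard, ← Nat.card_eq_fintype_card, Nat.card_coe_set_eq]

/-- A face of dimension below `finrank ℝ E` is a face of one of the facets. -/
theorem exists_subset_of_finrank_ne [Nonempty ι] (h : IsFacetSystem x 𝓕) {B : Set E}
    (hB : IsExposed ℝ (convexHull ℝ (range x)) B) (hne : B.Nonempty)
    (hdim : Module.finrank ℝ (vectorSpan ℝ B) ≠ Module.finrank ℝ E) :
    ∃ S ∈ 𝓕, ∃ T ⊆ S, B = convexHull ℝ (x '' T) ∧
      Module.finrank ℝ (vectorSpan ℝ B) + 1 = T.ncard := by
  have hBT := hB.eq_convexHull_image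
  have hnu : {i | x i ∈ B} ≠ univ := by
    intro hu
    rw [hu, image_univ] at hBT
    apply hdim
    rw [hBT, ← direction_affineSpan, h.affineSpan_convexHull_eq_top, AffineSubspace.direction_top,
      finrank_top]
  obtain ⟨S, hS, hT⟩ := h.exists_subset_of_isExposed hB hne hnu
  refine ⟨S, hS, _, hT, hBT, ?_⟩
  have hTne : {i | x i ∈ B}.Nonempty := by
    rw [hBT] at hne
    exact (convexHull_nonempty_iff.1 hne).of_image
  rw [← h.finrank_vectorSpan_add_one hS hT hTne, ← hBT]

/-- The face poset is determined by the facet system. -/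
theorem nonempty_orderIso [Nonempty ι] (h : IsFacetSystem x 𝓕) :
    Nonempty ({F : Set E // IsExposed ℝ (convexHull ℝ (range x)) F} ≃o
      {T : Set ι // T = univ ∨ ∃ S ∈ 𝓕, T ⊆ S}) := by
  have hT : ∀ F : {F : Set E // IsExposed ℝ (convexHull ℝ (range x)) F},
      {i | x i ∈ F.1} = univ ∨ ∃ S ∈ 𝓕, {i | x i ∈ F.1} ⊆ S := by
    rintro ⟨F, hF⟩
    by_cases hu : {i | x i ∈ F} = univ
    · exact Or.inl hu
    rcases F.eq_empty_or_nonempty with rfl | hne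
    -- The empty face corresponds to `∅`, which is admissible once some facet exists.
    · obtain ⟨S, hS, -⟩ := h.exists_mem (Classical.arbitrary ι)
      exact Or.inr ⟨S, hS, fun i hi => hi.elim⟩
    · exact Or.inr (h.exists_subset_of_isExposed hF hne hu)
  let φ : {F : Set E // IsExposed ℝ (convexHull ℝ (range x)) F} →
      {T : Set ι // T = univ ∨ ∃ S ∈ 𝓕, T ⊆ S} := fun F => ⟨{i | x i ∈ F.1}, hT F⟩
  have hle : ∀ F G, φ F ≤ φ G ↔ F ≤ G := by
    rintro ⟨F, hF⟩ ⟨G, hG⟩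
    constructor
    · intro hFG
      change F ⊆ G
      rw [hF.eq_convexHull_image, hG.eq_convexHull_image]
      exact convexHull_mono (image_mono hFG)
    · intro hFG i hi
      exact hFG hi
  have hsurj : Function.Surjective φ := by
    rintro ⟨T, rfl | ⟨S, hS, hTS⟩⟩
    · refine ⟨⟨_, IsExposed.refl _⟩, Subtype.ext (eq_univ_of_forall fun i => ?_)⟩
      exact subset_convexHull ℝ _ (mem_range_self i)
    · obtain ⟨g, hg⟩ := h.exists_supportsAt_of_subset hS hTS
      refine ⟨⟨_, hg.isExposed⟩, Subtype.ext (ext fun i => ?_)⟩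
      exact ⟨fun hi => hg.apply_eq_zero_iff.1 hi.2,
        fun hi => ⟨subset_convexHull ℝ _ (mem_range_self i), hg.1 i hi⟩⟩
  exact ⟨RelIso.ofSurjective (OrderEmbedding.ofMapLEIff φ hle) hsurj⟩

/-- An affine function supporting the polytope along the facet of `S`. -/
theorem _root_.SupportsAt.of_zeros_eq {S : Set ι} {g g' : E →ᵃ[ℝ] ℝ} (hg : SupportsAt x S g)
    (h0 : ∀ z ∈ convexHull ℝ (range x), 0 ≤ g' z)
    (h1 : convexHull ℝ (x '' S) = {z ∈ convexHull ℝ (range x) | g' z = 0}) :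
    SupportsAt x S g' := by
  have hmem : ∀ i, x i ∈ convexHull ℝ (range x) := fun i =>
    subset_convexHull ℝ _ (mem_range_self i)
  rw [← hg.zeros_eq] at h1
  have key : ∀ i, g' (x i) = 0 ↔ i ∈ S := by
    intro i
    rw [← hg.apply_eq_zero_iff]
    have := Set.ext_iff.1 h1 (x i)
    exact ⟨fun hi => (this.2 ⟨hmem i, hi⟩).2, fun hi => (this.1 ⟨hmem i, hi⟩).2⟩
  exact ⟨fun i hi => (key i).2 hi,
    fun i hi => lt_of_le_of_ne (h0 _ (hmem i)) fun h => hi ((key i).1 h.symm)⟩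

end IsFacetSystem

/-! ### Facets, edges and stackings in Euclidean space -/

section Euclidean

variable {d : ℕ} [Finite ι] [Nonempty ι] {x : ι → EuclideanSpace ℝ (Fin d)} {𝓕 : Set (Set ι)}

namespace IsFacetSystem

theorem isFullPolytope (h : IsFacetSystem x 𝓕) : IsFullPolytope (convexHull ℝ (range x)) :=
  ⟨⟨range x, finite_range x, rfl⟩, h.affineSpan_convexHull_eq_top⟩

theorem combEquiv {y : ι → EuclideanSpace ℝ (Fin d)} (hx : IsFacetSystem x 𝓕)
    (hy : IsFacetSystem y 𝓕) : CombEquiv (convexHull ℝ (range x)) (convexHull ℝ (range y)) := by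
  obtain ⟨e⟩ := hx.nonempty_orderIso
  obtain ⟨e'⟩ := hy.nonempty_orderIso
  exact ⟨e.trans e'.symm⟩

theorem eq_convexHull_of_isFacet (h : IsFacetSystem x 𝓕) {F : Set (EuclideanSpace ℝ (Fin d))}
    (hF : IsFacet (convexHull ℝ (range x)) F) : ∃ S ∈ 𝓕, F = convexHull ℝ (x '' S) := by
  obtain ⟨hexp, hne, hdim⟩ := hF
  have hd : Module.finrank ℝ (EuclideanSpace ℝ (Fin d)) = d := by simp
  obtain ⟨S, hS, T, hTS, rfl, hcard⟩ := h.exists_subset_of_finrank_ne hexp hne (by omega)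
  have hST : T = S := by
    refine eq_of_subset_of_ncard_le hTS ?_ (toFinite S)
    rw [h.ncard_eq S hS]
    omega
  exact ⟨S, hS, by rw [hST]⟩

omit [Nonempty ι] in
theorem isFacet (h : IsFacetSystem x 𝓕) (hd0 : d ≠ 0) {S : Set ι} (hS : S ∈ 𝓕) :
    IsFacet (convexHull ℝ (range x)) (convexHull ℝ (x '' S)) := by
  have hd : Module.finrank ℝ (EuclideanSpace ℝ (Fin d)) = d := by simp
  obtain ⟨g, hg⟩ := h.exists_supportsAt S hS
  have hSne : S.Nonempty := nonempty_of_ncard_ne_zero (by rw [h.ncard_eq S hS]; omega)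
  refine ⟨hg.zeros_eq ▸ hg.isExposed, (hSne.image x).convexHull, ?_⟩
  rw [h.finrank_vectorSpan_add_one hS Subset.rfl hSne, h.ncard_eq S hS, hd]

/-- For `d ≠ 1` an edge is a proper face, hence spanned by two vertices of a common facet. -/
theorem eq_segment_of_isEdge (h : IsFacetSystem x 𝓕) (hd1 : d ≠ 1)
    {e : Set (EuclideanSpace ℝ (Fin d))} (he : IsEdge (convexHull ℝ (range x)) e) :
    ∃ S ∈ 𝓕, ∃ i ∈ S, ∃ j ∈ S, i ≠ j ∧ e = segment ℝ (x i) (x j) := by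
  obtain ⟨hexp, hdim⟩ := he
  have hd : Module.finrank ℝ (EuclideanSpace ℝ (Fin d)) = d := by simp
  have hne : e.Nonempty := by
    rw [nonempty_iff_ne_empty]
    rintro rfl
    rw [vectorSpan_empty, finrank_bot] at hdim
    omega
  obtain ⟨S, hS, T, hTS, rfl, hcard⟩ := h.exists_subset_of_finrank_ne hexp hne (by omega)
  rw [hdim] at hcard
  obtain ⟨i, j, hij, rfl⟩ := ncard_eq_two.1 hcard.symm
  exact ⟨S, hS, i, hTS (by simp), j, hTS (by simp), hij, by rw [image_pair, convexHull_pair]⟩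

/-- The functionals witnessing beyond and beneath give supporting functions `c - l`; uniqueness up
to positive factors carries the sign at `w` to every supporting function. -/
theorem exists_of_isStackingOf (h : IsFacetSystem x 𝓕) (hd0 : d ≠ 0)
    {P' : Set (EuclideanSpace ℝ (Fin d))} (hP' : IsStackingOf (convexHull ℝ (range x)) P') :
    ∃ S ∈ 𝓕, ∃ (w : EuclideanSpace ℝ (Fin d)) (g : EuclideanSpace ℝ (Fin d) →ᵃ[ℝ] ℝ),
      SupportsAt x S g ∧ g w < 0 ∧
      (∀ S' ∈ 𝓕, S' ≠ S → ∀ g, SupportsAt x S' g → 0 < g w) ∧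
      P' = convexHull ℝ (range fun o : Option ι => o.elim w x) := by
  obtain ⟨F, w, hF, -, ⟨l, c, hl, hFl, hlw⟩, hbeneath, rfl⟩ := hP'
  obtain ⟨S, hS, rfl⟩ := h.eq_convexHull_of_isFacet hF
  let a : (EuclideanSpace ℝ (Fin d) →L[ℝ] ℝ) → ℝ → EuclideanSpace ℝ (Fin d) →ᵃ[ℝ] ℝ := fun l c =>
    AffineMap.const ℝ _ c - (l : EuclideanSpace ℝ (Fin d) →ₗ[ℝ] ℝ).toAffineMap
  have ha : ∀ l c z, a l c z = c - l z := fun _ _ _ => rfl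
  have hsupp : ∀ S ∈ 𝓕, ∀ l c, (∀ z ∈ convexHull ℝ (range x), l z ≤ c) →
      convexHull ℝ (x '' S) = {z ∈ convexHull ℝ (range x) | l z = c} → SupportsAt x S (a l c) := by
    intro S hS l c h0 h1
    obtain ⟨g, hg⟩ := h.exists_supportsAt S hS
    refine hg.of_zeros_eq (fun z hz => by rw [ha]; linarith [h0 z hz]) ?_
    rw [h1]
    ext z
    simp only [ha, sub_eq_zero, eq_comm (a := c)]
  refine ⟨S, hS, w, a l c, hsupp S hS l c hl hFl, by rw [ha]; linarith, ?_, ?_⟩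
  · intro S' hS' hne g' hg'
    have hneF : convexHull ℝ (x '' S') ≠ convexHull ℝ (x '' S) := by
      intro heq
      obtain ⟨g, hg⟩ := h.exists_supportsAt S hS
      apply hne
      ext i
      rw [← hg.apply_eq_zero_iff, ← hg'.apply_eq_zero_iff]
      have hmem : x i ∈ convexHull ℝ (range x) := subset_convexHull ℝ _ (mem_range_self i)
      rw [← hg.zeros_eq, ← hg'.zeros_eq] at heq
      have := Set.ext_iff.1 heq (x i)
      exact ⟨fun hi => (this.1 ⟨hmem, hi⟩).2, fun hi => (this.2 ⟨hmem, hi⟩).2⟩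
    obtain ⟨l', c', h0, h1, h2⟩ := hbeneath _ (h.isFacet hd0 hS') hneF
    obtain ⟨k, hk, rfl⟩ := (hsupp S' hS' l' c' h0 h1).eq_smul hg' (h.ncard_eq S' hS')
      (h.affineIndependent S' hS') (h.ne_univ S' hS')
    exact mul_pos hk (sub_pos.2 h2)
  · rw [range_option_elim, ← union_singleton, ← union_singleton, convexHull_convexHull_union_left]

end IsFacetSystem

end Euclidean

/-! ### Deep cuts and their extension to a stacked vertex -/

/-- The hyperplanes `h i = 0` cut off the vertices `x i` of the simplicial polytope with facets
`𝓕`, and on each edge the two hyperplanes belonging to its endpoints meet in a point. -/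
structure IsDeepCut (x : ι → E) (𝓕 : Set (Set ι)) (h : ι → E →ᵃ[ℝ] ℝ) : Prop where
  neg : ∀ i, h i (x i) < 0
  pos : ∀ i j, i ≠ j → 0 < h i (x j)
  mul_eq : ∀ S ∈ 𝓕, ∀ i ∈ S, ∀ j ∈ S, i ≠ j → h i (x i) * h j (x j) = h i (x j) * h j (x i)

namespace IsDeepCut

variable {x : ι → E} {𝓕 : Set (Set ι)} {h : ι → E →ᵃ[ℝ] ℝ}

/-- The point that remains of an edge. -/
theorem exists_mem_openSegment (hx : IsDeepCut x 𝓕 h) {S : Set ι} (hS : S ∈ 𝓕) {i j : ι}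
    (hi : i ∈ S) (hj : j ∈ S) (hij : i ≠ j) :
    ∃ p ∈ openSegment ℝ (x i) (x j), h i p = 0 ∧ h j p = 0 ∧ (∀ k, 0 ≤ h k p) ∧
      ∀ z ∈ segment ℝ (x i) (x j), 0 ≤ h i z → 0 ≤ h j z → z = p := by
  have hii := hx.neg i
  have hjj := hx.neg j
  have hpij := hx.pos i j hij
  have hpji := hx.pos j i hij.symm
  have hm := hx.mul_eq S hS i hi j hj hij
  have hden : 0 < h i (x j) - h i (x i) := by linarith
  set t := -h i (x i) / (h i (x j) - h i (x i)) with ht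
  have ht0 : 0 < t := div_pos (by linarith) hden
  have ht1 : t < 1 := by rw [ht, div_lt_one hden]; linarith
  have happ : ∀ (k : ι) (r : ℝ), h k (AffineMap.lineMap (x i) (x j) r) =
      (1 - r) * h k (x i) + r * h k (x j) := by
    intro k r
    rw [AffineMap.apply_lineMap, AffineMap.lineMap_apply_ring]
  have h1 : (1 - t) * h i (x i) + t * h i (x j) = 0 := by
    rw [ht]; field_simp; ring
  -- The product identity `hm` says that the zero of `h i` is also the zero of `h j`.
  have h2 : (1 - t) * h j (x i) + t * h j (x j) = 0 := by
    rw [ht]; field_simp; linarith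
  refine ⟨AffineMap.lineMap (x i) (x j) t, ?_, ?_, ?_, ?_, ?_⟩
  · rw [openSegment_eq_image_lineMap]
    exact ⟨t, ⟨ht0, ht1⟩, rfl⟩
  · rw [happ, h1]
  · rw [happ, h2]
  · intro k
    rw [happ]
    by_cases hki : k = i
    · rw [hki, h1]
    by_cases hkj : k = j
    · rw [hkj, h2]
    · have := mul_pos (sub_pos.2 ht1) (hx.pos k i hki)
      have := mul_pos ht0 (hx.pos k j hkj)
      linarith
  · intro z hz hiz hjz
    rw [segment_eq_image_lineMap] at hz
    obtain ⟨r, -, rfl⟩ := hz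
    rw [happ] at hiz hjz
    -- Along the edge `h i` increases and `h j` decreases, so the two inequalities bound `r` from
    -- opposite sides.
    have hrt : t ≤ r := by nlinarith
    have htr : r ≤ t := by nlinarith
    rw [le_antisymm htr hrt]

/-- A facet contains a point beneath all other facets that no vertex truncation removes. -/
theorem exists_mem_facet [FiniteDimensional ℝ E] [Finite ι] (hx : IsDeepCut x 𝓕 h)
    (hF : IsFacetSystem x 𝓕) (hE : 3 ≤ Module.finrank ℝ E) {S : Set ι} (hS : S ∈ 𝓕)
    {f : Set ι → E →ᵃ[ℝ] ℝ} (hf : ∀ S ∈ 𝓕, SupportsAt x S (f S)) :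
    ∃ z ∈ convexHull ℝ (x '' S), (∀ S' ∈ 𝓕, S' ≠ S → 0 < f S' z) ∧ ∀ i, 0 < h i z := by
  have hedge : ∀ i ∈ S, ∀ j ∈ S, i ≠ j → ∃ p ∈ openSegment ℝ (x i) (x j),
      p ∈ convexHull ℝ (x '' S) ∧ ∀ k, 0 ≤ h k p := by
    intro i hi j hj hij
    obtain ⟨p, hp, -, -, hp', -⟩ := hx.exists_mem_openSegment hS hi hj hij
    exact ⟨p, hp, segment_subset_convexHull (mem_image_of_mem x hi) (mem_image_of_mem x hj)
      (openSegment_subset_segment ℝ _ _ hp), hp'⟩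
  have hpos : ∀ g : E →ᵃ[ℝ] ℝ, ∀ i j, 0 < g (x i) → 0 ≤ g (x j) →
      ∀ p ∈ openSegment ℝ (x i) (x j), 0 < g p := by
    intro g i j hi hj p hp
    rw [openSegment_eq_image_lineMap] at hp
    obtain ⟨t, ht, rfl⟩ := hp
    rw [AffineMap.apply_lineMap, AffineMap.lineMap_apply_ring]
    have := mul_pos (sub_pos.2 ht.2) hi
    have := mul_nonneg ht.1.le hj
    linarith
  have hcardS : S.ncard = Module.finrank ℝ E := hF.ncard_eq S hS
  have htwo : ∀ i, ∃ j ∈ S, j ≠ i := fun i => exists_ne_of_one_lt_ncard (by omega) i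
  -- The truncated facet. It suffices that each required function is positive somewhere on `K`, and
  -- edge points will witness this.
  let K : Set E := convexHull ℝ (x '' S) ∩ ⋂ k, (h k) ⁻¹' Ici 0
  have hK : Convex ℝ K := (convex_convexHull ℝ _).inter
    (convex_iInter fun k => (convex_Ici 0).affine_preimage (h k))
  have hsub : ∀ z ∈ K, z ∈ convexHull ℝ (range x) := fun z hz =>
    convexHull_mono (image_subset_range x S) hz.1
  have hKmem : ∀ p, p ∈ convexHull ℝ (x '' S) → (∀ k, 0 ≤ h k p) → p ∈ K := fun p h1 h2 =>
    ⟨h1, mem_iInter.2 h2⟩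
  have hne : K.Nonempty := by
    obtain ⟨i, hi⟩ : S.Nonempty := nonempty_of_ncard_ne_zero (by omega)
    obtain ⟨j, hj, hji⟩ := htwo i
    obtain ⟨p, -, hp1, hp2⟩ := hedge i hi j hj hji.symm
    exact ⟨p, hKmem p hp1 hp2⟩
  obtain ⟨z, hz, hzpos⟩ := hK.exists_forall_pos hne (t := {a : Set ι ⊕ ι | ∀ S', a = .inl S' →
      S' ∈ 𝓕 ∧ S' ≠ S}) (toFinite _) (g := Sum.elim f h) (by
    rintro (S' | k) ha z hz
    · exact (hf S' (ha S' rfl).1).nonneg (hsub z hz)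
    · exact mem_iInter.1 hz.2 k) (by
    rintro (S' | k) ha
    · obtain ⟨hS', hne'⟩ := ha S' rfl
      obtain ⟨i, hi, hiS'⟩ : ∃ i ∈ S, i ∉ S' := by
        by_contra! hsub
        refine hne' (eq_of_subset_of_ncard_le hsub ?_ (toFinite S')).symm
        rw [hcardS, hF.ncard_eq S' hS']
      obtain ⟨j, hj, hji⟩ := htwo i
      obtain ⟨p, hp, hp1, hp2⟩ := hedge i hi j hj hji.symm
      exact ⟨p, hKmem p hp1 hp2,
        hpos _ i j ((hf S' hS').2 i hiS') ((hf S' hS').nonneg_apply j) p hp⟩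
    -- As `S` has at least three elements, some edge of the facet avoids `x k`; `h k` is positive on
    -- it.
    · obtain ⟨i, ⟨hi, hik⟩, j, ⟨hj, hjk⟩, hij⟩ : ∃ i ∈ S \ {k}, ∃ j ∈ S \ {k}, i ≠ j := by
        have : S.ncard - 1 ≤ (S \ {k}).ncard := pred_ncard_le_ncard_sdiff_singleton S k
        exact (one_lt_ncard (toFinite _)).1 (by omega)
      obtain ⟨p, hp, hp1, hp2⟩ := hedge i hi j hj hij
      exact ⟨p, hKmem p hp1 hp2, hpos _ i j (hx.pos k i (Ne.symm hik))
        (hx.pos k j (Ne.symm hjk)).le p hp⟩)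
  refine ⟨z, hz.1, fun S' hS' hne' => hzpos (.inl S') ?_, fun i => hzpos (.inr i) ?_⟩
  · rintro _ ⟨⟩
    exact ⟨hS', hne'⟩
  · rintro _ ⟨⟩

/-- A new vertex can be stacked onto any facet so that the polytope still has a deep vertex
truncation. -/
theorem exists_stack [FiniteDimensional ℝ E] [Finite ι] (hx : IsDeepCut x 𝓕 h)
    (hF : IsFacetSystem x 𝓕) (hE : 3 ≤ Module.finrank ℝ E) {S : Set ι} (hS : S ∈ 𝓕) :
    ∃ (w : E) (h' : Option ι → E →ᵃ[ℝ] ℝ),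
      IsFacetSystem (fun o : Option ι => o.elim w x) (stackFacets 𝓕 S) ∧
        IsDeepCut (fun o : Option ι => o.elim w x) (stackFacets 𝓕 S) h' := by
  obtain ⟨f, hf, -⟩ := hF.exists_family
  obtain ⟨z, hzS, hzf, hzh⟩ := hx.exists_mem_facet hF hE hS hf
  obtain ⟨j₀, hj₀⟩ := (ne_univ_iff_exists_notMem S).1 (hF.ne_univ S hS)
  obtain ⟨ε, hε, hpos⟩ := exists_pos_lineMap (t := {a : Set ι ⊕ ι | ∀ S', a = .inl S' →
      S' ∈ 𝓕 ∧ S' ≠ S}) (toFinite _) (g := Sum.elim f h) (z := z) (by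
    rintro (S' | k) ha
    · exact hzf S' (ha S' rfl).1 (ha S' rfl).2
    · exact hzh k) (x j₀)
  set w := AffineMap.lineMap z (x j₀) (-ε) with hw
  have hwf : ∀ S' ∈ 𝓕, S' ≠ S → 0 < f S' w := fun S' hS' hne => hpos (.inl S') (by
    rintro _ ⟨⟩
    exact ⟨hS', hne⟩)
  have hwh : ∀ i, 0 < h i w := fun i => hpos (.inr i) (by rintro _ ⟨⟩)
  have hg := hf S hS
  have hgz : f S z = 0 := AffineMap.eq_zero_of_mem_convexHull
    (by rintro _ ⟨i, hi, rfl⟩; exact hg.1 i hi) hzS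
  have hgw : f S w < 0 := by
    rw [hw, AffineMap.apply_lineMap, AffineMap.lineMap_apply_ring, hgz]
    have := mul_pos hε (hg.2 j₀ hj₀)
    linarith
  have hwall : ∀ S' ∈ 𝓕, S' ≠ S → ∀ g, SupportsAt x S' g → 0 < g w := by
    intro S' hS' hne g hg'
    obtain ⟨k, hk, rfl⟩ := (hf S' hS').eq_smul hg' (hF.ncard_eq S' hS')
      (hF.affineIndependent S' hS') (hF.ne_univ S' hS')
    exact mul_pos hk (hwf S' hS' hne)
  have hstack := hF.stack (by omega) hS hg hgw hwall
  clear_value w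
  obtain ⟨b, hb, rfl⟩ := hF.exists_affineBasis hS hg hgw.ne
  have := Fintype.ofFinite S
  -- With `H w = -1`, this is the value at `x i` for which `H` and `h i` vanish at the same point of
  -- the new edge.
  let a : S → ℝ := fun i => -h i (x i) / h i (b none)
  have ha : ∀ i, 0 < a i := fun i => div_pos (by linarith [hx.neg i]) (hwh i)
  let ev : E → (E →ᵃ[ℝ] ℝ) →+ ℝ := fun y =>
    { toFun := fun k => k y, map_zero' := rfl, map_add' := fun _ _ => rfl }
  let H : E →ᵃ[ℝ] ℝ := (∑ i : S, a i • b.coord (some i)) - b.coord none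
  have hH : ∀ y, H y = (∑ i : S, a i * b.coord (some i) y) - b.coord none y := fun y =>
    congrArg (· - b.coord none y)
      (map_sum (ev y) (fun i : S => a i • b.coord (some i)) Finset.univ)
  have hHw : H (b none) = -1 := by
    rw [hH, b.coord_apply_eq, Finset.sum_eq_zero]
    · norm_num
    · intro i _
      rw [b.coord_apply_ne (by simp), mul_zero]
  have hHS : ∀ i : S, H (x i) = a i := by
    intro i
    classical
    rw [hH, ← hb i, b.coord_apply_ne (by simp), Finset.sum_eq_single i, b.coord_apply_eq]
    · ring
    · intro k _ hk
      rw [b.coord_apply_ne (by simpa using hk), mul_zero]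
    · simp
  have hHpos : ∀ j, 0 < H (x j) := by
    intro j
    by_cases hj : j ∈ S
    · exact hHS ⟨j, hj⟩ ▸ ha _
    · have h1 := b.eq_smul_coord_none hb hg.1 (x j)
      have h2 := hg.2 j hj
      have h3 : 0 ≤ ∑ i : S, a i * b.coord (some i) (x j) := Finset.sum_nonneg fun i _ =>
        mul_nonneg (ha i).le (hF.coord_pos hS hg hb hgw hwall
          (subset_convexHull ℝ _ (mem_range_self j)) h2 i).le
      have h4 : b.coord none (x j) < 0 := by
        by_contra! hcon
        have := mul_nonpos_of_nonpos_of_nonneg hgw.le hcon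
        linarith
      -- The cone property makes the sum nonnegative, and `x j` lies across the facet from `w`, so
      -- its coordinate at `w` is negative.
      rw [hH]
      linarith
  have hHmul : ∀ j ∈ S, H (b none) * h j (x j) = H (x j) * h j (b none) := by
    intro j hj
    have := (hwh j).ne'
    rw [hHw, hHS ⟨j, hj⟩]
    simp only [a]
    field_simp
  refine ⟨b none, fun o => o.elim H h, hstack, ?_, ?_, ?_⟩
  · rintro (_ | i)
    · exact hHw ▸ neg_one_lt_zero
    · exact hx.neg i
  · rintro (_ | i) (_ | j) hij
    · exact absurd rfl hij
    · exact hHpos j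
    · exact hwh i
    · exact hx.pos i j fun h => hij (congrArg some h)
  · rintro _ (⟨S', hS', -, rfl⟩ | ⟨k, hk, rfl⟩)
    · rintro _ ⟨i, hi, rfl⟩ _ ⟨j, hj, rfl⟩ hij
      exact hx.mul_eq S' hS' i hi j hj fun h => hij (congrArg some h)
    · rintro _ (rfl | ⟨i, hi, rfl⟩) _ (rfl | ⟨j, hj, rfl⟩) hij
      · exact absurd rfl hij
      · exact hHmul j hj.1
      · have := hHmul i hi.1
        change h i (x i) * H (b none) = h i (b none) * H (x i)
        linarith
      · exact hx.mul_eq S hS i hi.1 j hj.1 fun h => hij (congrArg some h)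

end IsDeepCut

/-! ### The simplex as base case -/

section Simplex

variable {κ : Type*} [Finite κ] (b : AffineBasis κ ℝ E)

omit [Finite κ] in
theorem AffineBasis.supportsAt_coord (i : κ) : SupportsAt b {i}ᶜ (b.coord i) := by
  classical
  refine ⟨fun j hj => b.coord_apply_ne (Ne.symm hj), fun j hj => ?_⟩
  obtain rfl : j = i := by simpa using hj
  rw [b.coord_apply_eq]
  exact one_pos

theorem AffineBasis.isFacetSystem [FiniteDimensional ℝ E] [Nontrivial κ] :
    IsFacetSystem b {T | ∃ i, T = {i}ᶜ} := by
  have := Fintype.ofFinite κ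
  refine ⟨?_, ?_, ?_, ?_, ?_, ?_⟩
  · rintro _ ⟨i, rfl⟩
    rw [ncard_compl, ncard_singleton, Nat.card_eq_fintype_card, b.card_eq_finrank_add_one]
    rfl
  · rintro _ ⟨i, rfl⟩
    exact b.ind.comp_embedding (Function.Embedding.subtype _)
  · rintro _ ⟨i, rfl⟩ hu
    exact (hu ▸ mem_univ i : i ∈ ({i}ᶜ : Set κ)) rfl
  · intro i
    obtain ⟨j, hj⟩ := exists_ne i
    exact ⟨_, ⟨j, rfl⟩, hj.symm⟩
  · rintro _ ⟨i, rfl⟩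
    exact ⟨_, b.supportsAt_coord i⟩
  · intro z hz
    rw [b.convexHull_eq_nonneg_coord]
    exact fun i => hz _ ⟨i, rfl⟩ _ (b.supportsAt_coord i)

omit [Finite κ] in
-- Cutting where the `i`-th barycentric coordinate is `1 / 2` meets every edge at `b i` in its
-- midpoint.
theorem AffineBasis.isDeepCut (𝓕 : Set (Set κ)) :
    IsDeepCut b 𝓕 fun i => AffineMap.const ℝ E 1 - (2 : ℝ) • b.coord i := by
  have h1 : ∀ i, (AffineMap.const ℝ E 1 - (2 : ℝ) • b.coord i : E →ᵃ[ℝ] ℝ) (b i) = -1 := by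
    intro i
    simp
    norm_num
  have h2 : ∀ i j, i ≠ j →
      (AffineMap.const ℝ E 1 - (2 : ℝ) • b.coord i : E →ᵃ[ℝ] ℝ) (b j) = 1 := by
    intro i j hij
    simp [b.coord_apply_ne hij]
  refine ⟨fun i => ?_, fun i j hij => ?_, fun S _ i _ j _ hij => ?_⟩
  · rw [h1]; norm_num
  · rw [h2 i j hij]; norm_num
  · rw [h1, h1, h2 i j hij, h2 j i hij.symm]; norm_num

end Simplex

/-! ### From deep cuts to the theorem -/

theorem CombEquiv.trans {d : ℕ} {P Q R : Set (EuclideanSpace ℝ (Fin d))} (h : CombEquiv P Q)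
    (h' : CombEquiv Q R) : CombEquiv P R :=
  h.elim fun e => h'.elim fun e' => ⟨e.trans e'⟩

theorem IsDeepCut.admitsDeepVertexTruncation {d : ℕ} (hd : 3 ≤ d) [Finite ι] [Nonempty ι]
    {x : ι → EuclideanSpace ℝ (Fin d)} {𝓕 : Set (Set ι)}
    {h : ι → EuclideanSpace ℝ (Fin d) →ᵃ[ℝ] ℝ} (hx : IsDeepCut x 𝓕 h)
    (hF : IsFacetSystem x 𝓕) : AdmitsDeepVertexTruncation (convexHull ℝ (range x)) := by
  have hinj := hF.injective
  -- Chosen so that `f v z ≤ c v` means `0 ≤ h i z` for `v = x i`; the value `0` off the vertices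
  -- plays no role.
  let f : EuclideanSpace ℝ (Fin d) → (EuclideanSpace ℝ (Fin d) →L[ℝ] ℝ) :=
    Function.extend x (fun i => -(LinearMap.toContinuousLinearMap (h i).linear)) 0
  let c : EuclideanSpace ℝ (Fin d) → ℝ := Function.extend x (fun i => h i 0) 0
  have hfc : ∀ i z, h i z = c (x i) - f (x i) z := by
    intro i z
    simp only [f, c, hinj.extend_apply]
    rw [congrFun (h i).decomp z]
    simp
    ring
  have hext := hF.extremePoints_eq
  have htrunc : ∀ z, z ∈ vertexTruncation (convexHull ℝ (range x)) f c ↔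
      z ∈ convexHull ℝ (range x) ∧ ∀ i, 0 ≤ h i z := by
    intro z
    simp only [vertexTruncation, hext, mem_inter_iff, mem_iInter, forall_mem_range, hfc,
      sub_nonneg]
    rfl
  have hedge : ∀ e, IsEdge (convexHull ℝ (range x)) e → ∃ p, p ∈ intrinsicInterior ℝ e ∧
      e ∩ vertexTruncation (convexHull ℝ (range x)) f c = {p} ∧
      ∀ v ∈ (convexHull ℝ (range x)).extremePoints ℝ, v ∈ e → f v p = c v := by
    intro e he
    obtain ⟨S, hS, i, hi, j, hj, hij, rfl⟩ := hF.eq_segment_of_isEdge (by omega) he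
    obtain ⟨p, hp, hip, hjp, hnn, huniq⟩ := hx.exists_mem_openSegment hS hi hj hij
    have hpseg := openSegment_subset_segment ℝ _ _ hp
    have hsub := he.1.subset
    refine ⟨p, openSegment_subset_intrinsicInterior_segment
      ((hx.neg i).trans (hx.pos i j hij)) hp, ?_, ?_⟩
    · ext z
      rw [mem_inter_iff, htrunc]
      constructor
      · rintro ⟨hz, -, hz'⟩
        exact huniq z hz (hz' i) (hz' j)
      · rintro rfl
        exact ⟨hpseg, hsub hpseg, hnn⟩
    · rw [hext]
      rintro _ ⟨k, rfl⟩ hk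
      -- A function supporting exactly at `i` and `j` shows that a vertex on this edge is one of its
      -- endpoints.
      obtain ⟨g, hg⟩ := hF.exists_supportsAt_of_subset (T := {i, j}) hS
        (insert_subset hi (singleton_subset_iff.2 hj))
      have hgk : g (x k) = 0 := by
        rw [← convexHull_pair] at hk
        refine AffineMap.eq_zero_of_mem_convexHull ?_ hk
        rintro _ (rfl | rfl)
        · exact hg.1 i (by simp)
        · exact hg.1 j (by simp)
      have hkp : h k p = 0 := by
        rcases hg.apply_eq_zero_iff.1 hgk with rfl | rfl
        · exact hip
        · exact hjp
      rw [hfc] at hkp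
      linarith
  choose! p hp using hedge
  refine ⟨f, c, p, ?_, hp⟩
  rw [hext]
  rintro _ ⟨i, rfl⟩
  have hneg := hx.neg i
  obtain ⟨S, hS, hi⟩ := hF.exists_mem i
  obtain ⟨j, hj⟩ := (ne_univ_iff_exists_notMem S).1 (hF.ne_univ S hS)
  have hpos := hx.pos i j fun hij => hj (hij ▸ hi)
  rw [hfc] at hneg hpos
  -- If the linear part vanished, `h i` would be constant, yet it is negative at `x i` and positive
  -- at `x j`.
  refine ⟨fun h0 => ?_, by linarith⟩
  rw [h0] at hneg hpos
  simp only [zero_apply] at hneg hpos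
  linarith

/-- An iterated stacking and a suitable polytope with a deep vertex truncation have the same
facets. -/
theorem IsIteratedStacking.exists_isDeepCut {d : ℕ} (hd : 3 ≤ d) {n : ℕ}
    {P : Set (EuclideanSpace ℝ (Fin d))} (hP : IsIteratedStacking n P) :
    ∃ (ι : Type) (_ : Finite ι) (_ : Nonempty ι) (𝓕 : Set (Set ι))
      (x y : ι → EuclideanSpace ℝ (Fin d)) (h : ι → EuclideanSpace ℝ (Fin d) →ᵃ[ℝ] ℝ),
      IsFacetSystem x 𝓕 ∧ P = convexHull ℝ (range x) ∧ IsFacetSystem y 𝓕 ∧ IsDeepCut y 𝓕 h := by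
  have hE : 3 ≤ Module.finrank ℝ (EuclideanSpace ℝ (Fin d)) := by simpa using hd
  induction hP with
  | simplex P hP =>
    obtain ⟨p, hp, rfl⟩ := hP
    have htop : affineSpan ℝ (range p) = ⊤ := by
      rw [hp.affineSpan_eq_top_iff_card_eq_finrank_add_one]
      simp
    let b : AffineBasis (Fin (d + 1)) ℝ (EuclideanSpace ℝ (Fin d)) := ⟨p, hp, htop⟩
    have : Nontrivial (Fin (d + 1)) := Fin.nontrivial_iff_two_le.2 (by omega)
    exact ⟨Fin (d + 1), inferInstance, inferInstance, _, b, b, _, b.isFacetSystem, rfl,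
      b.isFacetSystem, b.isDeepCut _⟩
  | stack n P P' _ hstack ih =>
    obtain ⟨ι, _, _, 𝓕, x, y, h, hx, rfl, hy, hyh⟩ := ih
    -- The given stacking of `x` dictates `S`; `y` is stacked onto the same `S` with its own apex
    -- `w'`.
    obtain ⟨S, hS, w, g, hg, hgw, hw, rfl⟩ := hx.exists_of_isStackingOf (by omega) hstack
    obtain ⟨w', h', hy', hyh'⟩ := hyh.exists_stack hy hE hS
    exact ⟨Option ι, inferInstance, inferInstance, _, _, _, _, hx.stack (by omega) hS hg hgw hw,
      rfl, hy', hyh'⟩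

theorem mainTheorem4 (d : ℕ) (hd : 3 ≤ d) (n : ℕ)
    (P : Set (EuclideanSpace ℝ (Fin d))) (hP : HasStackType n P) :
    ∃ Q : Set (EuclideanSpace ℝ (Fin d)),
      IsFullPolytope Q ∧ CombEquiv P Q ∧ AdmitsDeepVertexTruncation Q := by
  obtain ⟨-, P₀, hP₀, hequiv⟩ := hP
  obtain ⟨ι, _, _, 𝓕, x, y, h, hx, rfl, hy, hyh⟩ := hP₀.exists_isDeepCut hd
  exact ⟨convexHull ℝ (range y), hy.isFullPolytope, hequiv.trans (hx.combEquiv hy),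
    hyh.admitsDeepVertexTruncation hd hy⟩
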